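/- Let $m,n$ be nonnegative integers, $A\in\mathbb{R}^{m\times n}$ with $\ker A\neq\{0\}$ (so that $n\ge 1$), $\xi>0$, and let $k\in[0,n]$ be real. Let $u=(u_1,\dots,u_n)$ be a random vector with i.i.d. coordinates such that $$\mathbf{P}[u_i=-1]=\mathbf{P}[u_i=1]=\frac{k}{2n},\qquad \mathbf{P}[u_i=0]=1-\frac{k}{n}.$$ Define $$S(A)=\max_{Ax=0,\;x\ne 0}\frac{\|x\|_2}{\|x\|_1},\qquad Z(u)=\max_{\substack{w\in\{-1,1\}^n\\ Ax=0,\ \|x\|_1\le 1}}\Big\{u^Tx+\xi\sum_{i=1}^n u_iw_ix_i\Big\},\qquad M(A)=\mathbf{E}[Z(u)].$$ Then both maxima are attained, $Z(u)$ and $\|u\|_2$ are integrable, $$M(A)\le(1+\xi)\,S(A)\,\mathbf{E}[\|u\|_2],$$ and, if $M(A)\le\xi$, $$\mathbf{P}\big[Z(u)\ge\xi\big]\le 4\exp\left(-\frac{(\xi-M(A))^2}{4(1+\xi)^2S(A)^2}\right).$$ -/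

import Mathlib

open MeasureTheory ProbabilityTheory
open scoped Matrix

noncomputable section

/-- The norm `‖x‖₁` on `ℝⁿ`. -/
def l1Norm {n : ℕ} (x : Fin n → ℝ) : ℝ := ‖WithLp.toLp 1 x‖

/-- The Euclidean norm `‖x‖₂` on `ℝⁿ`. -/
def l2Norm {n : ℕ} (x : Fin n → ℝ) : ℝ := ‖WithLp.toLp 2 x‖

theorem l1Norm_eq {n : ℕ} (x : Fin n → ℝ) : l1Norm x = ∑ i, |x i| := by
  simp [l1Norm, PiLp.norm_eq_of_L1]

theorem l2Norm_eq {n : ℕ} (x : Fin n → ℝ) : l2Norm x = √(∑ i, x i ^ 2) := by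
  simp [l2Norm, EuclideanSpace.norm_eq]

/-- The ratios `‖x‖₂ / ‖x‖₁` for nonzero `x` in the nullspace of `A`. -/
def normRatios {m n : ℕ} (A : Matrix (Fin m) (Fin n) ℝ) : Set ℝ :=
  {r | ∃ x : Fin n → ℝ, A *ᵥ x = 0 ∧ x ≠ 0 ∧ r = l2Norm x / l1Norm x}

/-- `S(A)`, the largest ratio `‖x‖₂ / ‖x‖₁` on the nullspace of `A`. -/
def maxNormRatio {m n : ℕ} (A : Matrix (Fin m) (Fin n) ℝ) : ℝ := sSup (normRatios A)

/-- The values `uᵀx + ξ ∑ uᵢ wᵢ xᵢ` for `Ax = 0`, `‖x‖₁ ≤ 1` and `w ∈ {-1, 1}ⁿ`. -/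
def processValues {m n : ℕ} (A : Matrix (Fin m) (Fin n) ℝ) (ξ : ℝ) (u : Fin n → ℝ) : Set ℝ :=
  {v | ∃ x w : Fin n → ℝ, A *ᵥ x = 0 ∧ l1Norm x ≤ 1 ∧ (∀ i, w i = -1 ∨ w i = 1) ∧
    v = u ⬝ᵥ x + ξ * ∑ i, u i * w i * x i}

/-- The maximum of `uᵀx + ξ ∑ uᵢ wᵢ xᵢ` over `Ax = 0`, `‖x‖₁ ≤ 1` and `w ∈ {-1, 1}ⁿ`. -/
def processMax {m n : ℕ} (A : Matrix (Fin m) (Fin n) ℝ) (ξ : ℝ) (u : Fin n → ℝ) : ℝ :=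
  sSup (processValues A ξ u)

/-- The random vector `u` has i.i.d. coordinates, each equal to `-1` with probability `k / 2n`,
to `1` with probability `k / 2n`, and to `0` with the remaining probability `1 - k / n`. -/
structure IsRandomSignal {Ω : Type*} [MeasurableSpace Ω] {n : ℕ} (k : ℝ)
    (u : Ω → Fin n → ℝ) (μ : Measure Ω) : Prop where
  measurable : ∀ i, Measurable (fun ω => u ω i)
  indep : iIndepFun (fun i ω => u ω i) μ
  prob_neg_one : ∀ i, μ.real {ω | u ω i = -1} = k / (2 * n)
  prob_one : ∀ i, μ.real {ω | u ω i = 1} = k / (2 * n)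
  prob_zero : ∀ i, μ.real {ω | u ω i = 0} = 1 - k / n

/-- `M(A)`, the expected value of the maximum. -/
def expectedMax {Ω : Type*} [MeasurableSpace Ω] {m n : ℕ} (A : Matrix (Fin m) (Fin n) ℝ)
    (ξ : ℝ) (u : Ω → Fin n → ℝ) (μ : Measure Ω) : ℝ :=
  ∫ ω, processMax A ξ (u ω) ∂μ

end

/-! ### The one-dimensional inequality -/

/-! As a maximum of functions linear in `u`, `processMax` is convex, and Cauchy–Schwarz makes it
Lipschitz with constant `L = (1 + ξ) S(A)` (`processMax_le_add`). Concentration comes from Maurey's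
infimum-convolution method: if `φ` is convex and `ψ x ≤ φ y + |x - y|² / 4` for all `x, y`, then `E
exp ψ ≤ exp (E φ)`. This is an elementary inequality for the three-point law
(`ConvexOn.exp_infConv_three_point`) and tensorizes (`signExpect_exp_infConv_le`). Taking `φ = t f`,
`ψ = t f - t² L²` bounds the moment generating function, and Chernoff's bound gives the tail, even
with 1 in place of 4. -/

theorem exp_sub_sq_le_one_add {c : ℝ} (hc : 0 ≤ c) : Real.exp (c - c ^ 2) ≤ 1 + c := by
  have h1 : c - c ^ 2 ≤ 1 - (1 + c)⁻¹ := by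
    have : 1 - (1 + c)⁻¹ = c / (1 + c) := by field_simp; ring
    rw [this, le_div_iff₀ (by linarith)]
    nlinarith [pow_nonneg hc 3]
  have h2 := Real.one_sub_inv_le_log_of_pos (x := 1 + c) (by linarith)
  exact (Real.exp_le_exp.2 (h1.trans h2)).trans_eq (Real.exp_log (by linarith))

theorem exp_quarter_le : Real.exp (1 / 4) ≤ 4 / 3 := by
  have h := Real.add_one_le_exp (-(1 / 4) : ℝ)
  rw [Real.exp_neg] at h
  have h0 := Real.exp_pos (1 / 4)
  rw [le_inv_comm₀ (by norm_num) h0] at h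
  norm_num at h ⊢
  linarith

/-- Because `(1 + s + s²/2)(1 - s + s²/2) = 1 + s⁴/4 ≥ 1`. -/
theorem exp_neg_le_quadratic {s : ℝ} (hs : 0 ≤ s) : Real.exp (-s) ≤ 1 - s + s ^ 2 / 2 := by
  have h := Real.quadratic_le_exp_of_nonneg hs
  have h0 := Real.exp_pos s
  rw [Real.exp_neg, inv_le_iff_one_le_mul₀ h0]
  nlinarith [pow_nonneg hs 4, mul_le_mul_of_nonneg_left h
    (show 0 ≤ 1 - s + s ^ 2 / 2 by nlinarith [sq_nonneg (s - 1)])]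

theorem exp_sub_sq_le_quadratic {s : ℝ} (h0 : 0 ≤ s) (h1 : s ≤ 1) :
    Real.exp (s - s ^ 2) ≤ 1 + s - s ^ 2 / 2 := by
  have hy : 0 ≤ s - s ^ 2 := by nlinarith
  have h := Real.exp_bound' (n := 3) hy (by nlinarith) (by norm_num)
  norm_num [Finset.sum_range_succ, Nat.factorial] at h
  -- The goal divided by `s²`; `2/9` is the Taylor remainder constant `4 / (3! * 3)`.
  have h2 : (1 - s) ^ 2 / 2 + 2 / 9 * (s * (1 - s) ^ 3) ≤ 1 / 2 := by
    have h3 : (1 - s) ^ 3 ≤ 1 := pow_le_one₀ (by linarith) (by linarith)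
    nlinarith [mul_le_mul_of_nonneg_left h3 h0]
  nlinarith [mul_le_mul_of_nonneg_left h2 (sq_nonneg s)]

theorem exp_le_one_add_of_forall_le {c t : ℝ} (hc : 0 ≤ c)
    (h : ∀ y ∈ Set.Icc (0 : ℝ) 1, t ≤ c * y + (1 - y) ^ 2 / 4) : Real.exp t ≤ 1 + c := by
  rcases le_total c (1 / 2) with h2 | h2
  -- The minimiser of the right-hand side, with value `c - c²`.
  · have := h (1 - 2 * c) ⟨by linarith, by linarith⟩
    exact (Real.exp_le_exp.2 (by nlinarith)).trans (exp_sub_sq_le_one_add hc)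
  · have := h 0 (by norm_num)
    have := (Real.exp_le_exp.2 (show t ≤ 1 / 4 by linarith)).trans exp_quarter_le
    linarith

/-- Here `a`, `c` are the increments of `φ` from 0 to the two endpoints. If `a = -r < 0`, the bound
on `exp s` exceeds `1 + a` by `r²/2`, so `exp t` must stay below `1 + c` by as much. For large `r`,
this comes from testing `t` on the opposite side of 0 (`ht'`). -/
theorem exp_add_exp_le_of_forall_le {a c s t : ℝ} (hac : 0 ≤ a + c) (hle : a ≤ c)
    (hs : ∀ y ∈ Set.Icc (0 : ℝ) 1, s ≤ a * y + (1 - y) ^ 2 / 4)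
    (ht : ∀ y ∈ Set.Icc (0 : ℝ) 1, t ≤ c * y + (1 - y) ^ 2 / 4)
    (ht' : ∀ y ∈ Set.Icc (0 : ℝ) 1, t ≤ a * y + (1 + y) ^ 2 / 4) :
    Real.exp s + Real.exp t ≤ 2 + a + c := by
  have hc : 0 ≤ c := by linarith
  rcases le_total 0 a with ha | ha
  · linarith [exp_le_one_add_of_forall_le ha hs, exp_le_one_add_of_forall_le hc ht]
  obtain ⟨r, rfl⟩ : ∃ r, a = -r := ⟨-a, by ring⟩
  have hr : 0 ≤ r := by linarith
  have hsa : Real.exp s ≤ Real.exp (-r) := Real.exp_le_exp.2 (by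
    have := hs 1 (by norm_num)
    linarith)
  have hq := hsa.trans (exp_neg_le_quadratic hr)
  rcases le_total c (1 / 2) with h2 | h2
  · have := ht (1 - 2 * c) ⟨by linarith, by linarith⟩
    have h3 : Real.exp t ≤ Real.exp (c - c ^ 2) := Real.exp_le_exp.2 (by nlinarith)
    have h4 := exp_sub_sq_le_quadratic hc (by linarith)
    nlinarith
  rcases le_total r (1 / 2) with h3 | h3
  · have := ht 0 (by norm_num)
    have := (Real.exp_le_exp.2 (show t ≤ 1 / 4 by linarith)).trans exp_quarter_le
    nlinarith
  rcases le_total r 1 with h4 | h4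
  -- The minimiser of `-r * y + (1 + y)² / 4`, with value `r - r²`.
  · have := ht' (2 * r - 1) ⟨by linarith, by linarith⟩
    have h5 : Real.exp t ≤ Real.exp (r - r ^ 2) := Real.exp_le_exp.2 (by nlinarith)
    have h6 := exp_sub_sq_le_quadratic hr h4
    nlinarith
  · have := ht' 1 (by norm_num)
    have h5 : Real.exp t ≤ 1 := Real.exp_le_one_iff.2 (by linarith)
    have h6 : Real.exp (-r) ≤ 1 := Real.exp_le_one_iff.2 (by linarith)
    linarith

/-- Chords from 0 bound `φ` above, leaving only its two increments, whose sum is nonnegative by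
convexity. The bound is then linear in `p`, and `1 + x ≤ exp x` finishes. -/
theorem ConvexOn.exp_infConv_three_point {φ ψ : ℝ → ℝ} (hφ : ConvexOn ℝ Set.univ φ)
    (h : ∀ x y, ψ x ≤ φ y + (x - y) ^ 2 / 4) {p : ℝ} (hp0 : 0 ≤ p) (hp1 : p ≤ 1) :
    (1 - p) * Real.exp (ψ 0) + p / 2 * Real.exp (ψ (-1)) + p / 2 * Real.exp (ψ 1) ≤
      Real.exp ((1 - p) * φ 0 + p / 2 * φ (-1) + p / 2 * φ 1) := by
  have hcv (e : ℝ) (y : ℝ) (hy : y ∈ Set.Icc (0 : ℝ) 1) :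
      φ (e * y) ≤ (1 - y) * φ 0 + y * φ e := by
    have := hφ.2 (Set.mem_univ 0) (Set.mem_univ e) (sub_nonneg.2 hy.2) hy.1 (by ring)
    simpa [mul_comm e y] using this
  have hsum : 0 ≤ (φ (-1) - φ 0) + (φ 1 - φ 0) := by
    have := hφ.2 (Set.mem_univ (-1)) (Set.mem_univ 1) (show (0 : ℝ) ≤ 1 / 2 by norm_num)
      (show (0 : ℝ) ≤ 1 / 2 by norm_num) (by norm_num)
    norm_num at this
    linarith
  have key : Real.exp (ψ (-1) - φ 0) + Real.exp (ψ 1 - φ 0) ≤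
      2 + (φ (-1) - φ 0) + (φ 1 - φ 0) := by
    have hA (y) (hy : y ∈ Set.Icc (0 : ℝ) 1) :
        ψ (-1) - φ 0 ≤ (φ (-1) - φ 0) * y + (1 - y) ^ 2 / 4 := by
      linarith [h (-1) (-1 * y), hcv (-1) y hy]
    have hA' (y) (hy : y ∈ Set.Icc (0 : ℝ) 1) :
        ψ (-1) - φ 0 ≤ (φ 1 - φ 0) * y + (1 + y) ^ 2 / 4 := by
      linarith [h (-1) (1 * y), hcv 1 y hy]
    have hC (y) (hy : y ∈ Set.Icc (0 : ℝ) 1) :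
        ψ 1 - φ 0 ≤ (φ 1 - φ 0) * y + (1 - y) ^ 2 / 4 := by
      linarith [h 1 (1 * y), hcv 1 y hy]
    have hC' (y) (hy : y ∈ Set.Icc (0 : ℝ) 1) :
        ψ 1 - φ 0 ≤ (φ (-1) - φ 0) * y + (1 + y) ^ 2 / 4 := by
      linarith [h 1 (-1 * y), hcv (-1) y hy]
    rcases le_total (φ (-1)) (φ 1) with hle | hle
    · exact exp_add_exp_le_of_forall_le hsum (by linarith) hA hC hC'
    · linarith [exp_add_exp_le_of_forall_le (by linarith) (by linarith) hC hA hA']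
  have hB : Real.exp (ψ 0 - φ 0) ≤ 1 := Real.exp_le_one_iff.2 (by
    have := h 0 0
    norm_num at this
    linarith)
  have hexp (x : ℝ) : Real.exp (ψ x) = Real.exp (φ 0) * Real.exp (ψ x - φ 0) := by
    rw [← Real.exp_add]; ring_nf
  have hR : Real.exp ((1 - p) * φ 0 + p / 2 * φ (-1) + p / 2 * φ 1) =
      Real.exp (φ 0) * Real.exp (p / 2 * ((φ (-1) - φ 0) + (φ 1 - φ 0))) := by
    rw [← Real.exp_add]; ring_nf
  have hT := Real.add_one_le_exp (p / 2 * ((φ (-1) - φ 0) + (φ 1 - φ 0)))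
  rw [hR, hexp 0, hexp (-1), hexp 1]
  have : (1 - p) * Real.exp (ψ 0 - φ 0) + p / 2 * Real.exp (ψ (-1) - φ 0)
      + p / 2 * Real.exp (ψ 1 - φ 0) ≤ Real.exp (p / 2 * ((φ (-1) - φ 0) + (φ 1 - φ 0))) := by
    nlinarith [mul_le_mul_of_nonneg_left hB (sub_nonneg.2 hp1),
      mul_le_mul_of_nonneg_left key (show 0 ≤ p / 2 by linarith)]
  linarith [mul_le_mul_of_nonneg_left this (Real.exp_pos (φ 0)).le]

/-! ### Tensorization -/

/-- The weights `p / 2, 1 - p, p / 2` of the points `-1, 0, 1`. -/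
noncomputable def signWeight (p : ℝ) (s : SignType) : ℝ := if s = 0 then 1 - p else p / 2

theorem sum_signWeight_mul (p : ℝ) (f : SignType → ℝ) :
    ∑ s, signWeight p s * f s = (1 - p) * f 0 + p / 2 * f (-1) + p / 2 * f 1 := by
  have : (Finset.univ : Finset SignType) = {0, -1, 1} := by decide
  rw [this, Finset.sum_insert (by decide), Finset.sum_insert (by decide), Finset.sum_singleton]
  have h1 : (-1 : SignType) ≠ 0 := by decide
  have h2 : (1 : SignType) ≠ 0 := by decide
  simp only [signWeight, h1, h2, if_true, if_false]
  ring

theorem signWeight_nonneg {p : ℝ} (hp0 : 0 ≤ p) (hp1 : p ≤ 1) (s : SignType) :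
    0 ≤ signWeight p s := by
  unfold signWeight
  split_ifs <;> linarith

/-- The expectation of `f` under the product of `n` copies of the three-point law. -/
noncomputable def signExpect (p : ℝ) (n : ℕ) (f : (Fin n → ℝ) → ℝ) : ℝ :=
  ∑ s : Fin n → SignType, (∏ i, signWeight p (s i)) * f (fun i => (s i : ℝ))

theorem signExpect_succ (p : ℝ) (n : ℕ) (f : (Fin (n + 1) → ℝ) → ℝ) :
    signExpect p (n + 1) f = (1 - p) * signExpect p n (fun y => f (Fin.cons 0 y)) +
      p / 2 * signExpect p n (fun y => f (Fin.cons (-1) y)) +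
      p / 2 * signExpect p n (fun y => f (Fin.cons 1 y)) := by
  have h := sum_signWeight_mul p (fun s => signExpect p n fun y => f (Fin.cons (s : ℝ) y))
  simp only [SignType.coe_zero, SignType.coe_one, SignType.coe_neg_one] at h
  rw [← h, signExpect, ← (Fin.consEquiv fun _ => SignType).sum_comp, Fintype.sum_prod_type]
  refine Finset.sum_congr rfl fun s _ => ?_
  rw [signExpect, Finset.mul_sum]
  refine Finset.sum_congr rfl fun t _ => ?_
  have : (fun i => ((Fin.consEquiv (fun _ => SignType) (s, t) i : SignType) : ℝ)) =
      Fin.cons (s : ℝ) (fun i => (t i : ℝ)) := by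
    ext i
    refine Fin.cases ?_ (fun j => ?_) i <;> simp [Fin.consEquiv]
  rw [this, Fin.prod_univ_succ]
  simp [Fin.consEquiv, mul_assoc]

theorem signExpect_pos {p : ℝ} (hp0 : 0 ≤ p) (hp1 : p ≤ 1) :
    ∀ {n : ℕ} {f : (Fin n → ℝ) → ℝ}, (∀ x, 0 < f x) → 0 < signExpect p n f
  | 0, f, hf => by simpa [signExpect] using hf _
  | n + 1, f, hf => by
    rw [signExpect_succ]
    have h (a : ℝ) : 0 < signExpect p n (fun y => f (Fin.cons a y)) :=
      signExpect_pos hp0 hp1 fun _ => hf _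
    rcases hp0.eq_or_lt with rfl | hp
    · simpa using h 0
    · have := mul_nonneg (sub_nonneg.2 hp1) (h 0).le
      have := mul_pos (half_pos hp) (h 1)
      have := mul_pos (half_pos hp) (h (-1))
      linarith

theorem signExpect_mul_const (p : ℝ) {n : ℕ} (f : (Fin n → ℝ) → ℝ) (c : ℝ) :
    signExpect p n (fun x => f x * c) = signExpect p n f * c := by
  simp only [signExpect, Finset.sum_mul, mul_assoc]

theorem convexOn_signExpect {p : ℝ} (hp0 : 0 ≤ p) (hp1 : p ≤ 1) {n : ℕ}
    {φ : (Fin (n + 1) → ℝ) → ℝ} (hφ : ConvexOn ℝ Set.univ φ) :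
    ConvexOn ℝ Set.univ (fun a => signExpect p n fun y => φ (Fin.cons a y)) := by
  refine ⟨convex_univ, fun a _ b _ α β hα hβ hαβ => ?_⟩
  simp only [signExpect, smul_eq_mul, Finset.mul_sum, ← Finset.sum_add_distrib]
  refine Finset.sum_le_sum fun s _ => ?_
  have h := hφ.2 (Set.mem_univ (Fin.cons a fun i => (s i : ℝ)))
    (Set.mem_univ (Fin.cons b fun i => (s i : ℝ))) hα hβ hαβ
  have he : α • (Fin.cons a fun i => (s i : ℝ) : Fin (n + 1) → ℝ) +
      β • (Fin.cons b fun i => (s i : ℝ) : Fin (n + 1) → ℝ) =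
      Fin.cons (α * a + β * b) fun i => (s i : ℝ) := by
    ext i
    refine Fin.cases ?_ (fun j => ?_) i
    · simp
    · simp [← add_mul, hαβ]
  rw [he] at h
  have hw : 0 ≤ ∏ i, signWeight p (s i) :=
    Finset.prod_nonneg fun i _ => signWeight_nonneg hp0 hp1 _
  simp only [smul_eq_mul] at h
  linarith [mul_le_mul_of_nonneg_left h hw]

/-- Induction on the dimension: with the first coordinate frozen, `log E exp ψ` and `E φ` again
satisfy the one-dimensional hypothesis, since the squared distance splits over coordinates. -/
theorem signExpect_exp_infConv_le {p : ℝ} (hp0 : 0 ≤ p) (hp1 : p ≤ 1) :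
    ∀ {n : ℕ} {φ ψ : (Fin n → ℝ) → ℝ}, ConvexOn ℝ Set.univ φ →
      (∀ x y, ψ x ≤ φ y + (∑ i, (x i - y i) ^ 2) / 4) →
      signExpect p n (fun x => Real.exp (ψ x)) ≤ Real.exp (signExpect p n φ)
  | 0, φ, ψ, _, h => by
    simpa [signExpect] using h _ _
  | n + 1, φ, ψ, hφ, h => by
    have hpos (a : ℝ) : 0 < signExpect p n (fun y => Real.exp (ψ (Fin.cons a y))) :=
      signExpect_pos hp0 hp1 fun _ => Real.exp_pos _
    have hcons (b : ℝ) : ConvexOn ℝ Set.univ (fun y : Fin n → ℝ => φ (Fin.cons b y)) := by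
      refine ⟨convex_univ, fun x _ y _ α β hα hβ hαβ => ?_⟩
      have he : α • (Fin.cons b x : Fin (n + 1) → ℝ) + β • (Fin.cons b y : Fin (n + 1) → ℝ) =
          Fin.cons b (α • x + β • y) := by
        ext i
        refine Fin.cases ?_ (fun j => ?_) i
        · simp [← add_mul, hαβ]
        · simp
      simpa only [he] using hφ.2 (Set.mem_univ (Fin.cons b x)) (Set.mem_univ (Fin.cons b y))
        hα hβ hαβ
    have step (a b : ℝ) :
        Real.log (signExpect p n (fun y => Real.exp (ψ (Fin.cons a y)))) ≤
          signExpect p n (fun y => φ (Fin.cons b y)) + (a - b) ^ 2 / 4 := by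
      have ih := signExpect_exp_infConv_le hp0 hp1 (n := n)
        (ψ := fun y => ψ (Fin.cons a y) - (a - b) ^ 2 / 4) (hcons b) (fun x y => by
          have := h (Fin.cons a x) (Fin.cons b y)
          simp only [Fin.sum_univ_succ, Fin.cons_zero, Fin.cons_succ] at this
          linarith)
      simp only [sub_eq_add_neg _ ((a - b) ^ 2 / 4), Real.exp_add, signExpect_mul_const] at ih
      rw [Real.exp_neg, ← div_eq_mul_inv, div_le_iff₀ (Real.exp_pos _), ← Real.exp_add] at ih
      exact (Real.log_le_iff_le_exp (hpos a)).2 ih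
    have := (convexOn_signExpect hp0 hp1 hφ).exp_infConv_three_point step hp0 hp1
    simp only [Real.exp_log (hpos _)] at this
    rwa [signExpect_succ, signExpect_succ p n φ]

/-! ### The maxima -/

theorem continuous_l1Norm {n : ℕ} : Continuous (l1Norm (n := n)) := by
  simp only [funext l1Norm_eq]
  fun_prop

theorem continuous_l2Norm {n : ℕ} : Continuous (l2Norm (n := n)) := by
  simp only [funext l2Norm_eq]
  fun_prop

theorem l1Norm_smul {n : ℕ} (c : ℝ) (x : Fin n → ℝ) : l1Norm (c • x) = |c| * l1Norm x := by
  simp [l1Norm_eq, abs_mul, Finset.mul_sum]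

theorem l2Norm_smul {n : ℕ} (c : ℝ) (x : Fin n → ℝ) : l2Norm (c • x) = |c| * l2Norm x := by
  simp [l2Norm, norm_smul]

theorem l1Norm_pos {n : ℕ} {x : Fin n → ℝ} (hx : x ≠ 0) : 0 < l1Norm x := by
  simpa [l1Norm] using hx

theorem l2Norm_pos {n : ℕ} {x : Fin n → ℝ} (hx : x ≠ 0) : 0 < l2Norm x := by
  simpa [l2Norm] using hx

theorem isCompact_of_l1Norm_le {n : ℕ} {s : Set (Fin n → ℝ)} (hs : IsClosed s) {r : ℝ}
    (h : ∀ x ∈ s, l1Norm x ≤ r) : IsCompact s := by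
  refine Metric.isCompact_of_isClosed_isBounded hs
    ((Metric.isBounded_closedBall (x := 0) (r := r)).subset fun x hx => ?_)
  have h0 := h x hx
  rw [l1Norm_eq] at h0
  rw [mem_closedBall_zero_iff, pi_norm_le_iff_of_nonneg
    ((Finset.sum_nonneg fun i _ => abs_nonneg (x i)).trans h0)]
  exact fun i => (Finset.single_le_sum (f := fun i => |x i|) (fun i _ => abs_nonneg _)
    (Finset.mem_univ i)).trans h0

theorem isClosed_mulVec_eq_zero {m n : ℕ} (A : Matrix (Fin m) (Fin n) ℝ) :
    IsClosed {x : Fin n → ℝ | A *ᵥ x = 0} :=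
  isClosed_eq (Continuous.matrix_mulVec continuous_const continuous_id) continuous_const

/-- The ratio is scale invariant, so the compact slice `‖x‖₁ = 1` of the kernel suffices. -/
theorem isGreatest_maxNormRatio {m n : ℕ} (A : Matrix (Fin m) (Fin n) ℝ)
    (hA : ∃ x : Fin n → ℝ, A *ᵥ x = 0 ∧ x ≠ 0) :
    IsGreatest (normRatios A) (maxNormRatio A) := by
  have himage : normRatios A = l2Norm '' ({x | A *ᵥ x = 0} ∩ {x | l1Norm x = 1}) := by
    ext r
    constructor
    · rintro ⟨x, hx, hx0, rfl⟩
      have hpos := l1Norm_pos hx0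
      refine ⟨(l1Norm x)⁻¹ • x, ⟨?_, ?_⟩, ?_⟩
      · simp [Matrix.mulVec_smul, hx]
      · simp [l1Norm_smul, abs_of_pos hpos, hpos.ne']
      · rw [l2Norm_smul, abs_of_pos (inv_pos.2 hpos)]
        ring
    · rintro ⟨x, ⟨hx, hx1⟩, rfl⟩
      rw [Set.mem_ofPred_eq] at hx1
      refine ⟨x, hx, ?_, by simp [hx1]⟩
      rintro rfl
      simp [l1Norm_eq] at hx1
  have hc : IsCompact (normRatios A) := by
    rw [himage]
    exact (isCompact_of_l1Norm_le ((isClosed_mulVec_eq_zero A).inter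
      (isClosed_eq continuous_l1Norm continuous_const)) fun x hx => hx.2.le).image
        continuous_l2Norm
  obtain ⟨x, hx, hx0⟩ := hA
  exact hc.isGreatest_sSup ⟨_, x, hx, hx0, rfl⟩

theorem maxNormRatio_pos {m n : ℕ} {A : Matrix (Fin m) (Fin n) ℝ}
    (hA : ∃ x : Fin n → ℝ, A *ᵥ x = 0 ∧ x ≠ 0) : 0 < maxNormRatio A := by
  obtain ⟨x, -, hx0, hr⟩ := (isGreatest_maxNormRatio A hA).1
  rw [hr]
  exact div_pos (l2Norm_pos hx0) (l1Norm_pos hx0)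

theorem l2Norm_le_maxNormRatio_mul {m n : ℕ} {A : Matrix (Fin m) (Fin n) ℝ} {x : Fin n → ℝ}
    (hx : A *ᵥ x = 0) : l2Norm x ≤ maxNormRatio A * l1Norm x := by
  by_cases hx0 : x = 0
  · subst hx0
    simp [l1Norm, l2Norm]
  · exact (div_le_iff₀ (l1Norm_pos hx0)).1
      ((isGreatest_maxNormRatio A ⟨x, hx, hx0⟩).2 ⟨x, hx, hx0, rfl⟩)

theorem isGreatest_processMax {m n : ℕ} (A : Matrix (Fin m) (Fin n) ℝ) (ξ : ℝ)
    (v : Fin n → ℝ) : IsGreatest (processValues A ξ v) (processMax A ξ v) := by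
  have himage : processValues A ξ v =
      (fun q : (Fin n → ℝ) × (Fin n → ℝ) => v ⬝ᵥ q.1 + ξ * ∑ i, v i * q.2 i * q.1 i) ''
        (({x | A *ᵥ x = 0} ∩ {x | l1Norm x ≤ 1}) ×ˢ
          Set.pi Set.univ fun _ => ({-1, 1} : Set ℝ)) := by
    ext r
    constructor
    · rintro ⟨x, w, hx, hx1, hw, rfl⟩
      exact ⟨(x, w), ⟨⟨hx, hx1⟩, by simpa using hw⟩, rfl⟩
    · rintro ⟨⟨x, w⟩, ⟨⟨hx, hx1⟩, hw⟩, rfl⟩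
      exact ⟨x, w, hx, hx1, by simpa using hw, rfl⟩
  have hc : IsCompact (processValues A ξ v) := by
    rw [himage]
    refine ((isCompact_of_l1Norm_le ((isClosed_mulVec_eq_zero A).inter
      (isClosed_le continuous_l1Norm continuous_const)) fun x hx => hx.2).prod
        (isCompact_univ_pi fun _ => (Set.toFinite _).isCompact)).image ?_
    unfold dotProduct
    fun_prop
  exact hc.isGreatest_sSup ⟨_, 0, fun _ => 1, by simp, by simp [l1Norm], by simp, rfl⟩

theorem dotProduct_le_l2Norm_mul {n : ℕ} (x y : Fin n → ℝ) :
    x ⬝ᵥ y ≤ l2Norm x * l2Norm y := by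
  rw [l2Norm_eq, l2Norm_eq]
  exact Real.sum_mul_le_sqrt_mul_sqrt _ _ _

/-- Sign changes preserve `‖x‖₂`, so Cauchy–Schwarz applies to both terms. -/
theorem process_value_le {m n : ℕ} {A : Matrix (Fin m) (Fin n) ℝ}
    (hA : ∃ x : Fin n → ℝ, A *ᵥ x = 0 ∧ x ≠ 0) {ξ : ℝ} (hξ : 0 < ξ) {x w : Fin n → ℝ}
    (hx : A *ᵥ x = 0) (hx1 : l1Norm x ≤ 1) (hw : ∀ i, w i = -1 ∨ w i = 1) (v : Fin n → ℝ) :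
    v ⬝ᵥ x + ξ * ∑ i, v i * w i * x i ≤ (1 + ξ) * maxNormRatio A * l2Norm v := by
  have hw2 : l2Norm (fun i => w i * x i) = l2Norm x := by
    rw [l2Norm_eq, l2Norm_eq]
    congr 1
    refine Finset.sum_congr rfl fun i _ => ?_
    rcases hw i with h | h <;> simp [h]
  have hS : l2Norm x ≤ maxNormRatio A := (l2Norm_le_maxNormRatio_mul hx).trans
    (mul_le_of_le_one_right (maxNormRatio_pos hA).le hx1)
  have h1 := dotProduct_le_l2Norm_mul v x
  have h2 := dotProduct_le_l2Norm_mul v (fun i => w i * x i)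
  rw [hw2] at h2
  have h3 : ∑ i, v i * w i * x i = v ⬝ᵥ fun i => w i * x i := by
    simp [dotProduct, mul_assoc]
  have h4 : l2Norm v * l2Norm x ≤ l2Norm v * maxNormRatio A :=
    mul_le_mul_of_nonneg_left hS (norm_nonneg _)
  rw [h3]
  nlinarith [mul_le_mul_of_nonneg_left (h2.trans h4) hξ.le]

theorem processMax_le {m n : ℕ} {A : Matrix (Fin m) (Fin n) ℝ}
    (hA : ∃ x : Fin n → ℝ, A *ᵥ x = 0 ∧ x ≠ 0) {ξ : ℝ} (hξ : 0 < ξ) (v : Fin n → ℝ) :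
    processMax A ξ v ≤ (1 + ξ) * maxNormRatio A * l2Norm v := by
  obtain ⟨x, w, hx, hx1, hw, hv⟩ := (isGreatest_processMax A ξ v).1
  rw [hv]
  exact process_value_le hA hξ hx hx1 hw v

theorem processMax_le_add {m n : ℕ} {A : Matrix (Fin m) (Fin n) ℝ}
    (hA : ∃ x : Fin n → ℝ, A *ᵥ x = 0 ∧ x ≠ 0) {ξ : ℝ} (hξ : 0 < ξ) (u v : Fin n → ℝ) :
    processMax A ξ u ≤ processMax A ξ v + (1 + ξ) * maxNormRatio A * l2Norm (u - v) := by
  obtain ⟨x, w, hx, hx1, hw, hu⟩ := (isGreatest_processMax A ξ u).1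
  have h1 := process_value_le hA hξ hx hx1 hw (u - v)
  have h2 := (isGreatest_processMax A ξ v).2 ⟨x, w, hx, hx1, hw, rfl⟩
  simp only [sub_dotProduct, Pi.sub_apply, sub_mul, Finset.sum_sub_distrib, mul_sub] at h1
  linarith

theorem convexOn_processMax {m n : ℕ} (A : Matrix (Fin m) (Fin n) ℝ) (ξ : ℝ) :
    ConvexOn ℝ Set.univ (processMax A ξ) := by
  refine ⟨convex_univ, fun u _ v _ α β hα hβ _ => ?_⟩
  obtain ⟨x, w, hx, hx1, hw, h⟩ := (isGreatest_processMax A ξ (α • u + β • v)).1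
  have hu := (isGreatest_processMax A ξ u).2 ⟨x, w, hx, hx1, hw, rfl⟩
  have hv := (isGreatest_processMax A ξ v).2 ⟨x, w, hx, hx1, hw, rfl⟩
  simp only [add_dotProduct, smul_dotProduct, Pi.add_apply, Pi.smul_apply, smul_eq_mul, add_mul,
    Finset.sum_add_distrib, mul_assoc, ← Finset.mul_sum] at h hu hv
  rw [h, smul_eq_mul, smul_eq_mul]
  linarith [mul_le_mul_of_nonneg_left hu hα, mul_le_mul_of_nonneg_left hv hβ]

/-! ### The law of the random signal -/

instance SignType.instMeasurableSpace : MeasurableSpace SignType := ⊤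

instance SignType.instDiscreteMeasurableSpace : DiscreteMeasurableSpace SignType :=
  ⟨fun _ => trivial⟩

theorem sign_signType_cast (s : SignType) : SignType.sign (s : ℝ) = s := by
  rcases s.trichotomy with rfl | rfl | rfl <;> simp

theorem measurable_sign_real : Measurable (SignType.sign : ℝ → SignType) := by
  refine measurable_to_countable' fun s => ?_
  rcases s.trichotomy with rfl | rfl | rfl
  · convert measurableSet_Iio (a := (0 : ℝ)) using 1
    ext x; simp [sign_eq_neg_one_iff]
  · convert measurableSet_singleton (0 : ℝ) using 1
    ext x; simp
  · convert measurableSet_Ioi (a := (0 : ℝ)) using 1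
    ext x; simp [sign_eq_one_iff]

namespace IsRandomSignal

variable {Ω : Type*} [MeasurableSpace Ω] {μ : Measure Ω} {n : ℕ} {k : ℝ} {u : Ω → Fin n → ℝ}

theorem measure_eq_sign (hu : IsRandomSignal k u μ) (i : Fin n) (s : SignType) :
    μ.real {ω | u ω i = s} = signWeight (k / n) s := by
  have h1 : (-1 : SignType) ≠ 0 := by decide
  have h2 : (1 : SignType) ≠ 0 := by decide
  rcases s.trichotomy with rfl | rfl | rfl
  · simpa [signWeight, h1, div_div, mul_comm] using hu.prob_neg_one i
  · simpa [signWeight] using hu.prob_zero i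
  · simpa [signWeight, h2, div_div, mul_comm] using hu.prob_one i

theorem ae_eq_sign [IsProbabilityMeasure μ] (hu : IsRandomSignal k u μ) :
    ∀ᵐ ω ∂μ, ∀ i, u ω i = (SignType.sign (u ω i) : ℝ) := by
  rw [ae_all_iff]
  intro i
  have hm (s : SignType) : MeasurableSet {ω | u ω i = s} :=
    hu.measurable i (measurableSet_singleton (s : ℝ))
  -- The three prescribed probabilities add up to 1, leaving no mass elsewhere.
  have hsum : μ.real (⋃ s : SignType, {ω | u ω i = s}) = 1 := by
    rw [measureReal_iUnion_fintype _ hm]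
    · simp only [hu.measure_eq_sign i]
      have := sum_signWeight_mul (k / n) fun _ => 1
      simp only [mul_one] at this
      rw [this]
      ring
    · intro s t hst
      refine Set.disjoint_left.2 fun ω hs ht => hst ?_
      have : (s : ℝ) = t := hs.symm.trans ht
      have := congrArg SignType.sign this
      rwa [sign_signType_cast, sign_signType_cast] at this
  have hae : ∀ᵐ ω ∂μ, ω ∈ ⋃ s : SignType, {ω | u ω i = s} := by
    refine (mem_ae_iff_prob_eq_one (MeasurableSet.iUnion hm)).2 ?_
    exact (ENNReal.toReal_eq_one_iff _).1 hsum
  filter_upwards [hae] with ω hω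
  obtain ⟨s, hs⟩ := Set.mem_iUnion.1 hω
  rw [Set.mem_ofPred_eq] at hs
  rw [hs, sign_signType_cast]

theorem measurable_sign (hu : IsRandomSignal k u μ) :
    Measurable fun ω i => SignType.sign (u ω i) :=
  measurable_pi_lambda _ fun i => measurable_sign_real.comp (hu.measurable i)

theorem measure_sign_eq [IsProbabilityMeasure μ] (hu : IsRandomSignal k u μ)
    (s : Fin n → SignType) :
    (μ.map fun ω i => SignType.sign (u ω i)).real {s} = ∏ i, signWeight (k / n) (s i) := by
  have hset : (fun ω i => SignType.sign (u ω i)) ⁻¹' {s} =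
      ⋂ i ∈ Finset.univ, (fun ω => u ω i) ⁻¹' (SignType.sign ⁻¹' {s i}) := by
    ext ω
    simp [funext_iff]
  rw [map_measureReal_apply hu.measurable_sign (measurableSet_singleton s), hset, Measure.real,
    hu.indep.measure_inter_preimage_eq_mul Finset.univ
      fun i _ => measurable_sign_real (measurableSet_singleton (s i)), ENNReal.toReal_prod]
  refine Finset.prod_congr rfl fun i _ => ?_
  rw [← hu.measure_eq_sign i (s i)]
  refine measureReal_congr ?_
  filter_upwards [hu.ae_eq_sign] with ω hω
  refine propext ⟨fun h => ?_, fun h => ?_⟩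
  · have h : SignType.sign (u ω i) = s i := h
    change u ω i = (s i : ℝ)
    rw [hω i, h]
  · have h : u ω i = (s i : ℝ) := h
    change SignType.sign (u ω i) = s i
    rw [h, sign_signType_cast]

theorem ae_eq_comp_sign [IsProbabilityMeasure μ] (hu : IsRandomSignal k u μ)
    (f : (Fin n → ℝ) → ℝ) :
    (fun ω => f (u ω)) =ᵐ[μ] (fun s : Fin n → SignType => f fun i => (s i : ℝ)) ∘
      fun ω i => SignType.sign (u ω i) := by
  filter_upwards [hu.ae_eq_sign] with ω hω
  exact congrArg f (funext hω)

theorem integrable_comp [IsProbabilityMeasure μ] (hu : IsRandomSignal k u μ)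
    (f : (Fin n → ℝ) → ℝ) : Integrable (fun ω => f (u ω)) μ :=
  (Integrable.comp_measurable Integrable.of_finite hu.measurable_sign).congr
    (hu.ae_eq_comp_sign f).symm

theorem integral_comp [IsProbabilityMeasure μ] (hu : IsRandomSignal k u μ)
    (f : (Fin n → ℝ) → ℝ) : ∫ ω, f (u ω) ∂μ = signExpect (k / n) n f := by
  rw [integral_congr_ae (hu.ae_eq_comp_sign f)]
  have h := integral_map (μ := μ) hu.measurable_sign.aemeasurable
    (f := fun s : Fin n → SignType => f fun i => (s i : ℝ))
    Integrable.of_finite.aestronglyMeasurable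
  simp only [Function.comp_def]
  rw [← h, integral_fintype Integrable.of_finite]
  simp only [hu.measure_sign_eq, smul_eq_mul, signExpect]

theorem mgf_le [IsProbabilityMeasure μ] (hu : IsRandomSignal k u μ) (hk0 : 0 ≤ k) (hkn : k ≤ n)
    {f : (Fin n → ℝ) → ℝ} (hf : ConvexOn ℝ Set.univ f) {L : ℝ}
    (hL : ∀ x y, f x ≤ f y + L * l2Norm (x - y)) {t : ℝ} (ht : 0 ≤ t) :
    mgf (fun ω => f (u ω)) μ t ≤ Real.exp (t * ∫ ω, f (u ω) ∂μ + t ^ 2 * L ^ 2) := by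
  have h := signExpect_exp_infConv_le (p := k / n) (div_nonneg hk0 (by positivity))
    (div_le_one_of_le₀ hkn (by positivity)) (φ := fun x => t * f x)
    (ψ := fun x => t * f x + -(t ^ 2 * L ^ 2)) (hf.smul ht) (fun x y => by
      have h1 := mul_le_mul_of_nonneg_left (hL x y) ht
      have h2 : l2Norm (x - y) ^ 2 = ∑ i, (x i - y i) ^ 2 := by
        rw [l2Norm_eq, Real.sq_sqrt (Finset.sum_nonneg fun i _ => sq_nonneg _)]
        rfl
      rw [← h2]
      -- Completing the square: `t L d ≤ t² L² + d² / 4`.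
      nlinarith [sq_nonneg (t * L - l2Norm (x - y) / 2)])
  simp only [Real.exp_add, signExpect_mul_const] at h
  rw [Real.exp_neg, ← div_eq_mul_inv, div_le_iff₀ (Real.exp_pos _), ← Real.exp_add,
    ← hu.integral_comp, ← hu.integral_comp, integral_const_mul] at h
  exact h

theorem measure_ge_le [IsProbabilityMeasure μ] (hu : IsRandomSignal k u μ) (hk0 : 0 ≤ k)
    (hkn : k ≤ n) {f : (Fin n → ℝ) → ℝ} (hf : ConvexOn ℝ Set.univ f) {L : ℝ} (hL0 : 0 < L)
    (hL : ∀ x y, f x ≤ f y + L * l2Norm (x - y)) {r : ℝ} (hr : ∫ ω, f (u ω) ∂μ ≤ r) :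
    μ.real {ω | r ≤ f (u ω)} ≤
      Real.exp (-((r - ∫ ω, f (u ω) ∂μ) ^ 2 / (4 * L ^ 2))) := by
  set M := ∫ ω, f (u ω) ∂μ
  -- The minimiser of the Chernoff exponent `-t r + t M + t² L²`.
  set t := (r - M) / (2 * L ^ 2) with ht
  have ht0 : 0 ≤ t := div_nonneg (by linarith) (by positivity)
  have h1 := measure_ge_le_exp_mul_mgf (μ := μ) (X := fun ω => f (u ω)) r ht0
    (hu.integrable_comp fun x => Real.exp (t * f x))
  refine h1.trans ((mul_le_mul_of_nonneg_left (hu.mgf_le hk0 hkn hf hL ht0)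
    (Real.exp_pos _).le).trans_eq ?_)
  rw [← Real.exp_add]
  congr 1
  rw [ht]
  field_simp
  ring

end IsRandomSignal

theorem mainTheorem9 {Ω : Type*} [MeasurableSpace Ω] (μ : Measure Ω) [IsProbabilityMeasure μ]
    {m n : ℕ} (A : Matrix (Fin m) (Fin n) ℝ) (hA : ∃ x : Fin n → ℝ, A *ᵥ x = 0 ∧ x ≠ 0)
    (ξ : ℝ) (hξ : 0 < ξ) (k : ℝ) (hk0 : 0 ≤ k) (hkn : k ≤ n)
    (u : Ω → Fin n → ℝ) (hu : IsRandomSignal k u μ) :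
    -- the maxima are attained and the expectations exist
    IsGreatest (normRatios A) (maxNormRatio A) ∧
    (∀ v : Fin n → ℝ, IsGreatest (processValues A ξ v) (processMax A ξ v)) ∧
    Integrable (fun ω => processMax A ξ (u ω)) μ ∧
    Integrable (fun ω => l2Norm (u ω)) μ ∧
    -- the bound on the expected maximum
    expectedMax A ξ u μ ≤ (1 + ξ) * maxNormRatio A * ∫ ω, l2Norm (u ω) ∂μ ∧
    -- the tail bound
    (expectedMax A ξ u μ ≤ ξ →
      μ.real {ω | ξ ≤ processMax A ξ (u ω)} ≤
        4 * Real.exp (-((ξ - expectedMax A ξ u μ) ^ 2 /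
          (4 * (1 + ξ) ^ 2 * maxNormRatio A ^ 2)))) := by
  have hint := hu.integrable_comp (processMax A ξ)
  have hint2 := hu.integrable_comp l2Norm
  refine ⟨isGreatest_maxNormRatio A hA, isGreatest_processMax A ξ, hint, hint2, ?_, fun hM => ?_⟩
  · rw [expectedMax, ← integral_const_mul]
    exact integral_mono hint (hint2.const_mul _) fun ω => processMax_le hA hξ (u ω)
  · have h := hu.measure_ge_le hk0 hkn (convexOn_processMax A ξ)
      (mul_pos (by linarith) (maxNormRatio_pos hA)) (processMax_le_add hA hξ) hM
    rw [mul_pow, ← mul_assoc] at h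
    exact h.trans (le_mul_of_one_le_left (Real.exp_pos _).le (by norm_num))
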